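/- Let $(\mathcal M,g)$ be a closed (compact, without boundary) connected smooth Riemannian manifold with geodesic distance $d_g$ and injectivity radius $R$. Let $\mathcal G=(\{1,\dots,N\},\mathcal E)$ be a connected undirected graph with weights $w_{ij}=w_{ji}$ that are positive on the edges, and let $\mathcal N_i$ be the set of neighbours of $i$. Let $$\mathcal C:=\{(x_i)_{i=1}^N\in\mathcal M^N \mid x_i=x_j \text{ for all } \{i,j\}\in\mathcal E\}$$ be the consensus manifold. For a metric $\rho$ on $\mathcal M$ and a function $f:\mathbb R\to[0,1]$ put $$W(x)=\tfrac12\sum_{\{i,j\}\in\mathcal E}w_{ij}\int_0^{\rho(x_i,x_j)^2}f(s)\,\mathrm ds,\qquad W_i(x)=\tfrac12\sum_{j\in\mathcal N_i}w_{ij}\int_0^{\rho(x_i,x_j)^2}f(s)\,\mathrm ds,$$ and consider the closed-loop system $\dot x_i=-\nabla_i W_i(x)$, $i=1,\dots,N$, on $\mathcal M^N$, where $\nabla_i$ is the Riemannian gradient with respect to $x_i$, the other states being held constant. (Since $\nabla_iW_i=\nabla_iW$, this is the gradient descent flow of $W$.) * *Geodesic consensus* is this system for $\rho=d_g$ and a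 function $f$ which, for some $0<\varepsilon<R$, equals $1$ on $[0,(R-\varepsilon)^2]$, equals $0$ on $[R^2,\infty)$, is smooth on $[(R-\varepsilon)^2,R^2]$, and is such that $W$ is $C^2$ on $\mathcal M^N$. (If $R=\infty$, then $f=1$ on $[0,\infty)$.) * *Chordal consensus* is this system for $f=1$ and $\rho(x,y)=\|\iota(x)-\iota(y)\|$, where $\iota:\mathcal M\hookrightarrow\mathbb R^{n\times m}$ is a smooth embedding that induces the metric $g$, and $\|\cdot\|$ is the Euclidean (Frobenius) norm. Then: 1. $\mathcal C$ is the diagonal of $\mathcal M^N$; it is compact, and $\mathcal M\to\mathcal M^N$, $p\mapsto(p,\dots,p)$, is a smooth embedding with image $\mathcal C$. 2. For both algorithms, $W\ge 0$ on $\mathcal M^N$, and $W(x)=0$ if and only if $x\in\mathcal C$. 3. $\mathcal C$ is a Lyapunov stable equilibrium set of both algorithms: every point of $\mathcal C$ is an equilibrium, and for every $\epsilon'>0$ there is $\delta>0$ such that every solution $x:[0,T]\to\mathcal M^N$, $T\ge 0$, for which $x(0)$ lies in the open $\delta$-neighbourhood of $\mathcal C$, remains in the open $\epsilon'$-neighbourhood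 of $\mathcal C$. Neighbourhoods are taken with respect to the product distance $\big(\sum_i d_g(x_i,y_i)^2\big)^{1/2}$. -/

import Mathlib

open Set Bundle Manifold
open scoped Manifold ContDiff ENNReal

noncomputable section

/-! ### Riemannian notions: geodesics, exponential map, injectivity radius, gradient -/

section Riemannian

/-- The map `f`, from a vector space to a manifold modelled on it, is a smooth local diffeomorphism
at every point of `s`. -/
def IsSmoothLocalDiffeoOn {E : Type*} [NormedAddCommGroup E] [NormedSpace ℝ E] {M : Type*}
    [TopologicalSpace M] [ChartedSpace E M] (f : E → M) (s : Set E) : Prop :=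
  IsLocalDiffeomorphOn 𝓘(ℝ, E) 𝓘(ℝ, E) ∞ f s

variable {d : ℕ} {M : Type*} [MetricSpace M] [ChartedSpace (EuclideanSpace ℝ (Fin d)) M]

/-- `γ : ℝ → M` has velocity `v` at time `t`, as a curve on the time set `J`. -/
def HasVelocityWithinAt (γ : ℝ → M) (J : Set ℝ) (t : ℝ) (v : TangentSpace (𝓡 d) (γ t)) : Prop :=
  HasMFDerivWithinAt 𝓘(ℝ, ℝ) (𝓡 d) γ J t ((1 : ℝ →L[ℝ] ℝ).smulRight v)

/-- A geodesic `ℝ → M`: a smooth curve which has constant speed and locally realises the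
distance. In a Riemannian manifold (where `dist` is the infimum of the lengths of curves) these are
exactly the solutions of the geodesic equation. -/
def IsGeodesicLine (d : ℕ) {M : Type*} [MetricSpace M]
    [ChartedSpace (EuclideanSpace ℝ (Fin d)) M] (γ : ℝ → M) : Prop :=
  ContMDiff 𝓘(ℝ, ℝ) (𝓡 d) ∞ γ ∧
    ∃ c : ℝ, 0 ≤ c ∧ ∀ t : ℝ, ∃ δ > 0, ∀ s ∈ Metric.ball t δ, ∀ s' ∈ Metric.ball t δ,
      dist (γ s) (γ s') = c * |s - s'|

open Classical in
/-- The exponential map: `expMap x v` is the time-one value of the geodesic which starts at `x`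
with velocity `v` (and `x`, if there is no such geodesic; in a complete Riemannian manifold there
is exactly one). -/
def expMap (x : M) (v : TangentSpace (𝓡 d) x) : M :=
  if h : ∃ γ : ℝ → M, IsGeodesicLine d γ ∧ γ 0 = x ∧
      HasMFDerivAt 𝓘(ℝ, ℝ) (𝓡 d) γ 0 ((1 : ℝ →L[ℝ] ℝ).smulRight (v : EuclideanSpace ℝ (Fin d)))
  then h.choose 1 else x

variable [RiemannianBundle (fun x : M ↦ TangentSpace (𝓡 d) x)]

/-- The injectivity radius at `x`: the supremum of the radii `r` for which `exp_x` is a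
diffeomorphism from the open ball of radius `r` in `T_x M` onto its image. -/
def injectivityRadiusAt (d : ℕ) {M : Type*} [MetricSpace M]
    [ChartedSpace (EuclideanSpace ℝ (Fin d)) M]
    [RiemannianBundle (fun x : M ↦ TangentSpace (𝓡 d) x)] (x : M) : ℝ≥0∞ :=
  sSup {r : ℝ≥0∞ |
    InjOn (expMap (d := d) x) {v : TangentSpace (𝓡 d) x | ‖v‖ₑ < r} ∧
    IsSmoothLocalDiffeoOn (fun v : EuclideanSpace ℝ (Fin d) ↦ expMap (d := d) x v)
      {v : TangentSpace (𝓡 d) x | ‖v‖ₑ < r}}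

/-- The injectivity radius of `M`. -/
def injectivityRadius (d : ℕ) (M : Type*) [MetricSpace M]
    [ChartedSpace (EuclideanSpace ℝ (Fin d)) M]
    [RiemannianBundle (fun x : M ↦ TangentSpace (𝓡 d) x)] : ℝ≥0∞ :=
  ⨅ x : M, injectivityRadiusAt d x

instance (x : M) : FiniteDimensional ℝ (TangentSpace (𝓡 d) x) :=
  inferInstanceAs (FiniteDimensional ℝ (EuclideanSpace ℝ (Fin d)))

instance (x : M) : CompleteSpace (TangentSpace (𝓡 d) x) := FiniteDimensional.complete ℝ _

/-- The Riemannian gradient of `φ` at `x`: the tangent vector which represents the differential of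
`φ` at `x` with respect to the metric. -/
def riemannianGradient (φ : M → ℝ) (x : M) : TangentSpace (𝓡 d) x :=
  (InnerProductSpace.toDual ℝ (TangentSpace (𝓡 d) x)).symm (mfderiv (𝓡 d) 𝓘(ℝ, ℝ) φ x)

end Riemannian

/-! ### Multi-agent systems on `M ^ N` and Lyapunov stability -/

section MultiAgent

variable {d N : ℕ} {M : Type*} [MetricSpace M] [ChartedSpace (EuclideanSpace ℝ (Fin d)) M]

/-- The curve `x` in `M ^ N` solves the closed-loop system `ẋ i = u x i`, for all agents `i`, on the
time set `J`. -/
def IsTrajectoryOn (u : ∀ (x : Fin N → M) (i : Fin N), TangentSpace (𝓡 d) (x i))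
    (x : ℝ → Fin N → M) (J : Set ℝ) : Prop :=
  ∀ t ∈ J, ∀ i : Fin N, HasVelocityWithinAt (fun s ↦ x s i) J t (u (x t) i)

/-- The geodesic distance of the product Riemannian manifold `M ^ N`. -/
def productDist (x y : Fin N → M) : ℝ := √(∑ i, dist (x i) (y i) ^ 2)

/-- The open `ε`-neighbourhood of `S` in the Riemannian manifold `M ^ N`. -/
def productNeighborhood (S : Set (Fin N → M)) (ε : ℝ) : Set (Fin N → M) :=
  {x | ∃ y ∈ S, productDist x y < ε}

/-- Every point of `S` is an equilibrium of the system `ẋ i = u x i`, and `S` is Lyapunov stable: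
for each `ε > 0` there is `δ > 0` such that every trajectory (on any time interval `[0, T]`) which
starts in the `δ`-neighbourhood of `S` stays in the `ε`-neighbourhood of `S`. -/
structure IsLyapunovStableEquilibriumSet
    (u : ∀ (x : Fin N → M) (i : Fin N), TangentSpace (𝓡 d) (x i)) (S : Set (Fin N → M)) :
    Prop where
  equilibrium : ∀ x ∈ S, ∀ i, u x i = 0
  stable : ∀ ε > 0, ∃ δ > 0, ∀ (T : ℝ) (x : ℝ → Fin N → M),
    IsTrajectoryOn u x (Icc 0 T) → x 0 ∈ productNeighborhood S δ →
      ∀ t ∈ Icc 0 T, x t ∈ productNeighborhood S ε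

end MultiAgent

/-! ### The consensus manifold, disagreement functions and the two algorithms -/

section Consensus

/-- The consensus manifold of the network `G`: neighbouring agents have equal states. -/
def consensusManifold {N : ℕ} (G : SimpleGraph (Fin N)) (M : Type*) : Set (Fin N → M) :=
  {x | ∀ i j, G.Adj i j → x i = x j}

open Classical in
/-- The disagreement function `W x = ½ ∑ w i j ∫₀ ^ (ρ (x i) (x j) ²) f`, where the sum is over the
edges `{i, j}` of `G`, each taken once, and `ρ` is a metric on `M`. -/
def disagreement {N : ℕ} {M : Type*} (G : SimpleGraph (Fin N)) (w : Fin N → Fin N → ℝ)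
    (ρ : M → M → ℝ) (f : ℝ → ℝ) (x : Fin N → M) : ℝ :=
  1 / 2 * ∑ p : Fin N × Fin N with p.1 < p.2 ∧ G.Adj p.1 p.2,
    w p.1 p.2 * ∫ s in (0 : ℝ)..(ρ (x p.1) (x p.2) ^ 2), f s

open Classical in
/-- The part `W i` of the disagreement which agent `i` can compute: the sum is over the neighbours
of `i`. -/
def localDisagreement {N : ℕ} {M : Type*} (G : SimpleGraph (Fin N)) (w : Fin N → Fin N → ℝ)
    (ρ : M → M → ℝ) (f : ℝ → ℝ) (i : Fin N) (x : Fin N → M) : ℝ :=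
  1 / 2 * ∑ j : Fin N with G.Adj i j, w i j * ∫ s in (0 : ℝ)..(ρ (x i) (x j) ^ 2), f s

variable {d N : ℕ} {M : Type*} [MetricSpace M] [ChartedSpace (EuclideanSpace ℝ (Fin d)) M]
  [RiemannianBundle (fun x : M ↦ TangentSpace (𝓡 d) x)]

/-- The feedback `u i = - ∇ᵢ W i`, where `∇ᵢ` is the Riemannian gradient with respect to the state
of agent `i`, the states of the other agents being held constant. -/
def consensusFeedback (G : SimpleGraph (Fin N)) (w : Fin N → Fin N → ℝ)
    (ρ : M → M → ℝ) (f : ℝ → ℝ) (x : Fin N → M) (i : Fin N) : TangentSpace (𝓡 d) (x i) :=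
  -riemannianGradient (d := d)
    (fun y : M ↦ localDisagreement G w ρ f i (Function.update x i y)) (x i)

/-- The smoothing functions of geodesic consensus, for a manifold of injectivity radius
`R ∈ (0, ∞]` and a network `(G, w)`: `f = 1` on `[0, (R - ε)²]`, `f = 0` on `[R², ∞)`, `f` is
smooth on `[(R - ε)², R²]`, and the resulting disagreement function is `C²` on `M ^ N`. (The
variable of `f` is written as `r ^ 2` with `r ≥ 0`; if `R = ∞`, then `f = 1` on `[0, ∞)`.) -/
structure IsGeodesicSmoothing (d : ℕ) {N : ℕ} {M : Type*} [MetricSpace M]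
    [ChartedSpace (EuclideanSpace ℝ (Fin d)) M]
    [RiemannianBundle (fun x : M ↦ TangentSpace (𝓡 d) x)]
    (G : SimpleGraph (Fin N)) (w : Fin N → Fin N → ℝ) (ε : ℝ) (f : ℝ → ℝ) : Prop where
  pos : 0 < ε
  lt_radius : ENNReal.ofReal ε < injectivityRadius d M
  mem_Icc : ∀ s, f s ∈ Icc (0 : ℝ) 1
  eq_one : ∀ r : ℝ, 0 ≤ r → ENNReal.ofReal r ≤ injectivityRadius d M - ENNReal.ofReal ε →
    f (r ^ 2) = 1
  eq_zero : ∀ r : ℝ, 0 ≤ r → injectivityRadius d M ≤ ENNReal.ofReal r → f (r ^ 2) = 0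
  smooth : ContDiffOn ℝ ∞ f ((fun r : ℝ ↦ r ^ 2) '' {r : ℝ | 0 ≤ r ∧
    injectivityRadius d M - ENNReal.ofReal ε ≤ ENNReal.ofReal r ∧
    ENNReal.ofReal r ≤ injectivityRadius d M})
  contMDiff : ContMDiff (ModelWithCorners.pi fun _ : Fin N ↦ 𝓡 d) 𝓘(ℝ, ℝ) 2
    (disagreement G w (fun p q : M ↦ dist p q) f)

/-- `ι` embeds the Riemannian manifold `M` in the Euclidean space `F`, and the metric of `M` is the
induced one. -/
structure IsIsometricEmbedding {F : Type*} [NormedAddCommGroup F] [InnerProductSpace ℝ F]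
    (ι : M → F) : Prop where
  isSmoothEmbedding : IsSmoothEmbedding (𝓡 d) 𝓘(ℝ, F) ∞ ι
  inner_eq : ∀ (x : M) (v v' : TangentSpace (𝓡 d) x),
    inner ℝ v v' = (inner ℝ : F → F → ℝ) (mfderiv (𝓡 d) 𝓘(ℝ, F) ι x v)
      (mfderiv (𝓡 d) 𝓘(ℝ, F) ι x v')

/-- The chordal distance of an embedded manifold: the Euclidean distance in the ambient space. -/
def chordalDist {M F : Type*} [NormedAddCommGroup F] (ι : M → F) (p q : M) : ℝ :=
  ‖ι p - ι q‖

/-- Geodesic consensus: `ẋ i = - ∇ᵢ V i`, with the geodesic distance and the smoothing function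
`f`. -/
def geodesicConsensus (d : ℕ) {N : ℕ} {M : Type*} [MetricSpace M]
    [ChartedSpace (EuclideanSpace ℝ (Fin d)) M]
    [RiemannianBundle (fun x : M ↦ TangentSpace (𝓡 d) x)]
    (G : SimpleGraph (Fin N)) (w : Fin N → Fin N → ℝ) (f : ℝ → ℝ)
    (x : Fin N → M) (i : Fin N) : TangentSpace (𝓡 d) (x i) :=
  consensusFeedback G w (fun p q : M ↦ dist p q) f x i

/-- Chordal consensus: `ẋ i = - ∇ᵢ U i`, with the chordal distance and the smoothing function
`1`. -/
def chordalConsensus (d : ℕ) {N : ℕ} {M : Type*} [MetricSpace M]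
    [ChartedSpace (EuclideanSpace ℝ (Fin d)) M]
    [RiemannianBundle (fun x : M ↦ TangentSpace (𝓡 d) x)]
    {F : Type*} [NormedAddCommGroup F] (ι : M → F)
    (G : SimpleGraph (Fin N)) (w : Fin N → Fin N → ℝ)
    (x : Fin N → M) (i : Fin N) : TangentSpace (𝓡 d) (x i) :=
  consensusFeedback G w (chordalDist ι) (fun _ ↦ 1) x i

end Consensus

end

/-!
# Stability of geodesic and chordal consensus

Both algorithms are the gradient descent flow of the disagreement `W`, and everything follows from
Lyapunov's direct method with `W` as Lyapunov function; the common argument is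
`isLyapunovStableEquilibriumSet_consensusFeedback`, which needs of the metric `ρ` and the function
`f` only that `∫₀ ^ (ρ p q ²) f` is symmetric and positive for `p ≠ q` and that `W` is
differentiable.

* `W` is a sum of nonnegative terms, so it vanishes exactly when neighbours agree
  (`disagreement_eq_zero_iff`). Hence every `W i` is minimal at a consensus, where its gradient
  vanishes: consensus points are equilibria.
* The terms of `W` which are not in `W i` do not depend on the state of agent `i`
  (`exists_disagreement_update_eq_add`), so the partial differentials of `W` and `W i` agree. By the
  chain rule in the product manifold, the derivative of `W` along a trajectory is minus the sum of
  the squared norms of the partial gradients, and `W` decreases (`antitoneOn_disagreement`).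
* As `M ^ N` is compact, `W` has a positive minimum outside each neighbourhood of the consensus
  manifold, and it is below this minimum on a smaller neighbourhood; a trajectory which starts there
  never leaves the larger one (`exists_pos_forall_trajectory_mem`).

For geodesic consensus, positivity of the integral holds since `f` equals `1` near `0`; its
integrability comes from the three pieces on which `f` is prescribed. In product charts, the
diagonal `M → M ^ N` is the linear diagonal, which has a linear complement
(`isSmoothEmbedding_diagonal`).
-/

open Filter Topology Function

/-! ### Finite products of manifolds -/

section PiManifold

variable {𝕜 : Type*} [NontriviallyNormedField 𝕜] {ι : Type*} [Fintype ι]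
  {E : ι → Type*} [∀ i, NormedAddCommGroup (E i)] [∀ i, NormedSpace 𝕜 (E i)]
  {H : ι → Type*} [∀ i, TopologicalSpace (H i)] {I : ∀ i, ModelWithCorners 𝕜 (E i) (H i)}
  {M : ι → Type*} [∀ i, TopologicalSpace (M i)] [∀ i, ChartedSpace (H i) (M i)]
  {E' : Type*} [NormedAddCommGroup E'] [NormedSpace 𝕜 E'] {H' : Type*} [TopologicalSpace H']
  {I' : ModelWithCorners 𝕜 E' H'} {M' : Type*} [TopologicalSpace M'] [ChartedSpace H' M']

theorem isManifold_pi {n : ℕ∞ω} [∀ i, IsManifold (I i) n (M i)] :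
    IsManifold (ModelWithCorners.pi I) n (∀ i, M i) := by
  refine isManifold_of_contDiffOn _ _ _ ?_
  rintro _ _ ⟨e, he, rfl⟩ ⟨e', he', rfl⟩
  refine contDiffOn_pi.2 fun i ↦ ?_
  have h := (contDiffGroupoid n (I i)).compatible (he i trivial) (he' i trivial)
  rw [contDiffGroupoid, mem_groupoid_of_pregroupoid] at h
  refine h.1.comp (ContinuousLinearMap.proj (R := 𝕜) (φ := E) i).contDiff.contDiffOn ?_
  rintro y ⟨⟨hy, hy'⟩, z, rfl⟩
  exact ⟨⟨hy i trivial, hy' i trivial⟩, z i, rfl⟩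

theorem hasMFDerivWithinAt_pi {f : M' → ∀ i, M i} {s : Set M'} {x : M'}
    {f' : ∀ i, E' →L[𝕜] E i}
    (h : ∀ i, HasMFDerivWithinAt I' (I i) (fun y ↦ f y i) s x (f' i)) :
    HasMFDerivWithinAt I' (ModelWithCorners.pi I) f s x (ContinuousLinearMap.pi f') :=
  ⟨continuousWithinAt_pi.2 fun i ↦ (h i).1, hasFDerivWithinAt_pi.2 fun i ↦ (h i).2⟩

theorem hasMFDerivAt_pi {f : M' → ∀ i, M i} {x : M'}
    {f' : ∀ i, E' →L[𝕜] E i}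
    (h : ∀ i, HasMFDerivAt I' (I i) (fun y ↦ f y i) x (f' i)) :
    HasMFDerivAt I' (ModelWithCorners.pi I) f x (ContinuousLinearMap.pi f') :=
  hasMFDerivWithinAt_univ.1 (hasMFDerivWithinAt_pi fun i ↦ (h i).hasMFDerivWithinAt)

theorem hasMFDerivAt_update [DecidableEq ι] (x : ∀ i, M i) (i : ι) :
    HasMFDerivAt (I i) (ModelWithCorners.pi I) (update x i) (x i)
      (ContinuousLinearMap.single 𝕜 E i) := by
  have h : ∀ j, HasMFDerivAt (I i) (I j) (fun y ↦ update x i y j) (x i)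
      ((ContinuousLinearMap.proj (R := 𝕜) (φ := E) j).comp
        (ContinuousLinearMap.single 𝕜 E i) : E i →L[𝕜] E j) := by
    intro j
    obtain rfl | hj := eq_or_ne j i
    · have e : (ContinuousLinearMap.proj (R := 𝕜) (φ := E) j).comp
          (ContinuousLinearMap.single 𝕜 E j) = ContinuousLinearMap.id 𝕜 (E j) := by ext; simp
      rw [e]
      exact (hasMFDerivAt_id (I := I j) (x j)).congr_of_eventuallyEq
        (.of_forall fun y ↦ update_self j y x)
    · have e : (ContinuousLinearMap.proj (R := 𝕜) (φ := E) j).comp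
          (ContinuousLinearMap.single 𝕜 E i) = 0 := by ext; simp [hj]
      rw [e]
      exact (hasMFDerivAt_const (I := I i) (I' := I j) (x j) (x i)).congr_of_eventuallyEq
        (.of_forall fun y ↦ update_of_ne hj y x)
  exact hasMFDerivAt_pi h

theorem hasMFDerivAt_apply (x : ∀ i, M i) (i : ι) :
    HasMFDerivAt (ModelWithCorners.pi I) (I i) (fun y : ∀ i, M i ↦ y i) x
      (ContinuousLinearMap.proj (R := 𝕜) (φ := E) i) := by
  refine ⟨(continuous_apply i).continuousAt, ?_⟩
  refine ((ContinuousLinearMap.proj (R := 𝕜) (φ := E) i).hasFDerivWithinAt).congr_of_eventuallyEq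
    ?_ ?_
  · filter_upwards [extChartAt_target_mem_nhdsWithin (I := ModelWithCorners.pi I) x] with y hy
    exact congrFun ((extChartAt (ModelWithCorners.pi I) x).right_inv hy) i
  · exact congrFun ((extChartAt (ModelWithCorners.pi I) x).right_inv
      (mem_extChartAt_target (I := ModelWithCorners.pi I) x)) i

end PiManifold

/-! ### The diagonal embedding -/

section Diagonal

variable {E : Type*} [NormedAddCommGroup E] [NormedSpace ℝ E] [FiniteDimensional ℝ E]
  {H : Type*} [TopologicalSpace H] {I : ModelWithCorners ℝ E H}
  {M : Type*} [TopologicalSpace M] [ChartedSpace H M] {ι : Type*} [Fintype ι]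

/-- The complement of the diagonal of `E ^ ι` is modelled on the families indexed by the `j ≠ i`,
for a fixed index `i`. -/
theorem isSmoothEmbedding_diagonal [Nonempty ι] {n : ℕ∞ω} [IsManifold I n M] :
    IsSmoothEmbedding I (ModelWithCorners.pi fun _ : ι ↦ I) n (fun (p : M) (_ : ι) ↦ p) := by
  classical
  obtain ⟨i⟩ := ‹Nonempty ι›
  have : IsManifold (ModelWithCorners.pi fun _ : ι ↦ I) n (ι → M) := isManifold_pi
  refine ⟨IsImmersionOfComplement.isImmersion (F := {j : ι // j ≠ i} → E) fun p ↦ ?_, ?_⟩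
  · -- `e (v, z)` has coordinate `v` at `i` and `v + z j` at `j ≠ i`: the diagonal is `z = 0`.
    let e : (E × ({j : ι // j ≠ i} → E)) ≃ₗ[ℝ] (ι → E) :=
      { toFun := fun v j ↦ if h : j ≠ i then v.1 + v.2 ⟨j, h⟩ else v.1
        map_add' := fun v v' ↦ by
          ext1 j; by_cases h : j = i
          · simp [h]
          · simp [h, add_add_add_comm]
        map_smul' := fun c v ↦ by
          ext1 j; by_cases h : j = i <;> simp [h]
        invFun := fun z ↦ (z i, fun j ↦ z j - z i)
        left_inv := fun v ↦ by
          ext1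
          · simp
          · ext1 j; simp [j.2]
        right_inv := fun z ↦ by
          ext1 j; by_cases h : j = i <;> simp [h] }
    refine IsImmersionAtOfComplement.mk_of_charts e.toContinuousLinearEquiv (chartAt H p)
      (chartAt (ModelPi fun _ : ι ↦ H) fun _ : ι ↦ p) (mem_chart_source H p) (mem_chart_source _ _)
      (IsManifold.chart_mem_maximalAtlas p) (IsManifold.chart_mem_maximalAtlas _)
      (fun q hq _ _ ↦ hq) fun y hy ↦ ?_
    have hy' : (extChartAt I p) ((extChartAt I p).symm y) = y := (extChartAt I p).right_inv hy
    ext1 j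
    trans y
    · exact hy'
    · by_cases h : j = i <;> simp [e, h]
  · exact .of_leftInverse (f := fun x : ι → M ↦ x i) (fun _ ↦ rfl) (continuous_apply i)
      (continuous_pi fun _ ↦ continuous_id)

end Diagonal

/-! ### Critical points -/

/-- No differentiability is needed: `mfderiv` is `0` where `φ` is not differentiable. -/
theorem IsLocalMin.mfderiv_eq_zero {E : Type*} [NormedAddCommGroup E] [NormedSpace ℝ E]
    {H : Type*} [TopologicalSpace H] {I : ModelWithCorners ℝ E H} [I.Boundaryless]
    {M : Type*} [TopologicalSpace M] [ChartedSpace H M] {φ : M → ℝ} {x : M}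
    (h : IsLocalMin φ x) : mfderiv I 𝓘(ℝ, ℝ) φ x = 0 := by
  by_cases hφ : MDifferentiableAt I 𝓘(ℝ, ℝ) φ x
  · have h' : IsLocalMin (writtenInExtChartAt I 𝓘(ℝ, ℝ) x φ) (extChartAt I x x) := by
      have hx := (continuousAt_extChartAt_symm (I := I) x).tendsto
      rw [extChartAt_to_inv] at hx
      filter_upwards [hx.eventually h] with y hy
      change φ ((extChartAt I x).symm (extChartAt I x x)) ≤ φ ((extChartAt I x).symm y)
      rwa [extChartAt_to_inv]
    have hd := hφ.hasMFDerivAt.2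
    rw [I.range_eq_univ] at hd
    exact h'.hasFDerivAt_eq_zero (hasFDerivWithinAt_univ.1 hd)
  · exact mfderiv_zero_of_not_mdifferentiableAt hφ

/-! ### Lyapunov functions on products -/

section Lyapunov

variable {d N : ℕ} {M : Type*} [MetricSpace M] [ChartedSpace (EuclideanSpace ℝ (Fin d)) M]

theorem dist_le_productDist (x y : Fin N → M) : dist x y ≤ productDist x y := by
  refine (dist_pi_le_iff (Real.sqrt_nonneg _)).2 fun i ↦ Real.le_sqrt_of_sq_le ?_
  exact Finset.single_le_sum (f := fun i ↦ dist (x i) (y i) ^ 2) (fun j _ ↦ sq_nonneg _)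
    (Finset.mem_univ i)

theorem isOpen_productNeighborhood (S : Set (Fin N → M)) (ε : ℝ) :
    IsOpen (productNeighborhood S ε) := by
  have h : productNeighborhood S ε = ⋃ y ∈ S, {x | productDist x y < ε} := by
    ext x; simp [productNeighborhood]
  rw [h]
  refine isOpen_biUnion fun y _ ↦ isOpen_lt ?_ continuous_const
  unfold productDist
  fun_prop

theorem subset_productNeighborhood (S : Set (Fin N → M)) {ε : ℝ} (hε : 0 < ε) :
    S ⊆ productNeighborhood S ε :=
  fun x hx ↦ ⟨x, hx, by simpa [productDist] using hε⟩

/-- Lyapunov's direct method, for a compact state space: outside a neighbourhood of its zero set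
`S`, the function `W` has a positive minimum, and a trajectory on which `W` starts below this
minimum cannot leave the neighbourhood. -/
theorem exists_pos_forall_trajectory_mem [CompactSpace M]
    {u : ∀ (x : Fin N → M) (i : Fin N), TangentSpace (𝓡 d) (x i)} {S : Set (Fin N → M)}
    {W : (Fin N → M) → ℝ} (hS : IsCompact S) (hW : Continuous W) (hW_nonneg : ∀ x, 0 ≤ W x)
    (hW_zero : ∀ x, W x = 0 ↔ x ∈ S)
    (hW_anti : ∀ (T : ℝ) (x : ℝ → Fin N → M), IsTrajectoryOn u x (Icc 0 T) →
      AntitoneOn (fun t ↦ W (x t)) (Icc 0 T)) {ε : ℝ} (hε : 0 < ε) :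
    ∃ δ > 0, ∀ (T : ℝ) (x : ℝ → Fin N → M), IsTrajectoryOn u x (Icc 0 T) →
      x 0 ∈ productNeighborhood S δ → ∀ t ∈ Icc 0 T, x t ∈ productNeighborhood S ε := by
  obtain ⟨c, hc, hcW⟩ : ∃ c > 0, ∀ x, W x < c → x ∈ productNeighborhood S ε := by
    obtain hne | hne := (productNeighborhood S ε)ᶜ.eq_empty_or_nonempty
    · exact ⟨1, one_pos, fun x _ ↦ compl_empty_iff.1 hne ▸ mem_univ x⟩
    · obtain ⟨z, hz, hmin⟩ := (isOpen_productNeighborhood S ε).isClosed_compl.isCompact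
        |>.exists_isMinOn hne hW.continuousOn
      refine ⟨W z, (hW_nonneg z).lt_of_ne fun h ↦ hz ?_, fun x hx ↦ ?_⟩
      · exact subset_productNeighborhood S hε ((hW_zero z).1 h.symm)
      · by_contra hx'
        exact hx.not_ge (hmin hx')
  obtain ⟨δ, hδ, hδW⟩ := hS.exists_thickening_subset_open (isOpen_lt hW continuous_const)
    fun x hx ↦ show W x < c from ((hW_zero x).2 hx).trans_lt hc
  refine ⟨δ, hδ, fun T x hx ⟨y, hy, hxy⟩ t ht ↦ hcW _ ?_⟩
  have h0 : W (x 0) < c :=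
    hδW (Metric.mem_thickening_iff.2 ⟨y, hy, (dist_le_productDist _ _).trans_lt hxy⟩)
  exact (hW_anti T x hx ⟨le_rfl, ht.1.trans ht.2⟩ ht ht.1).trans_lt h0

/-- The chain rule along a curve in a product manifold whose components have velocities `v i`. -/
theorem HasMFDerivAt.hasDerivWithinAt_comp_curve {x : ℝ → Fin N → M} {J : Set ℝ} {t : ℝ}
    {v : Fin N → EuclideanSpace ℝ (Fin d)} {W : (Fin N → M) → ℝ}
    {W' : (Fin N → EuclideanSpace ℝ (Fin d)) →L[ℝ] ℝ}
    (hW : HasMFDerivAt (ModelWithCorners.pi fun _ : Fin N ↦ 𝓡 d) 𝓘(ℝ, ℝ) W (x t) W')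
    (hx : ∀ i, HasVelocityWithinAt (fun s ↦ x s i) J t (v i)) :
    HasDerivWithinAt (fun s ↦ W (x s)) (W' v) J t := by
  let x' : ℝ →L[ℝ] Fin N → EuclideanSpace ℝ (Fin d) :=
    ContinuousLinearMap.pi fun i ↦ (1 : ℝ →L[ℝ] ℝ).smulRight (v i)
  have hx' : HasMFDerivWithinAt 𝓘(ℝ, ℝ) (ModelWithCorners.pi fun _ : Fin N ↦ 𝓡 d) x J t x' :=
    hasMFDerivWithinAt_pi hx
  have h : HasFDerivWithinAt (W ∘ x) (W'.comp x') J t :=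
    (HasMFDerivAt.comp_hasMFDerivWithinAt t hW hx').hasFDerivWithinAt
  have hv : x' 1 = v := by ext1 i; simp [x']
  rw [← hv]
  exact h.hasDerivWithinAt

end Lyapunov

/-! ### Riemannian gradients -/

section Gradient

variable {d : ℕ} {M : Type*} [MetricSpace M] [ChartedSpace (EuclideanSpace ℝ (Fin d)) M]
  [RiemannianBundle (fun x : M ↦ TangentSpace (𝓡 d) x)]

theorem inner_riemannianGradient (φ : M → ℝ) (x : M) (v : TangentSpace (𝓡 d) x) :
    inner ℝ (riemannianGradient φ x) v = mfderiv (𝓡 d) 𝓘(ℝ, ℝ) φ x v :=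
  InnerProductSpace.toDual_symm_apply

theorem riemannianGradient_eq_zero_of_isLocalMin {φ : M → ℝ} {x : M} (h : IsLocalMin φ x) :
    riemannianGradient (d := d) φ x = 0 := by
  unfold riemannianGradient
  rw [h.mfderiv_eq_zero]
  exact map_zero _

end Gradient

/-! ### The disagreement function and its gradient flow -/

section Disagreement

/-- A sum of symmetric terms over the pairs `a < b`, split into the pairs which contain `i` and those
which do not. -/
theorem sum_lt_eq_sum_add_sum_erase {N : ℕ} {T : Fin N → Fin N → ℝ} (hT : ∀ a b, T a b = T b a)
    (hT_diag : ∀ a, T a a = 0) (i : Fin N) :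
    ∑ p : Fin N × Fin N, (if p.1 < p.2 then T p.1 p.2 else 0) =
      ∑ j, T i j + ∑ a ∈ Finset.univ.erase i, ∑ b ∈ Finset.univ.erase i,
        if a < b then T a b else 0 := by
  -- `T i b` is counted once, as `g i b` or as `g b i`.
  set g : Fin N → Fin N → ℝ := fun a b ↦ if a < b then T a b else 0 with hg
  have hgT : ∀ b, g i b + g b i = T i b := by
    intro b
    obtain h | rfl | h := lt_trichotomy i b
    · simp [hg, h, h.not_gt]
    · simp [hg, hT_diag]
    · simp [hg, h, h.not_gt, hT i b]
  have hgi : g i i = 0 := by simp [hg]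
  calc ∑ p : Fin N × Fin N, g p.1 p.2 = ∑ a, ∑ b, g a b := Fintype.sum_prod_type _
    _ = ∑ b, g i b + ∑ a ∈ Finset.univ.erase i, ∑ b, g a b :=
      (Finset.add_sum_erase _ _ (Finset.mem_univ i)).symm
    _ = ∑ b, g i b + ∑ a ∈ Finset.univ.erase i, (g a i + ∑ b ∈ Finset.univ.erase i, g a b) := by
      simp_rw [Finset.add_sum_erase _ _ (Finset.mem_univ i)]
    _ = ∑ b, (g i b + g b i) + ∑ a ∈ Finset.univ.erase i, ∑ b ∈ Finset.univ.erase i, g a b := by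
      rw [Finset.sum_add_distrib, Finset.sum_add_distrib,
        ← Finset.add_sum_erase _ (fun a ↦ g a i) (Finset.mem_univ i), hgi]
      ring
    _ = _ := by simp_rw [hgT, hg]

variable {N : ℕ} {M : Type*} {G : SimpleGraph (Fin N)} {w : Fin N → Fin N → ℝ} {ρ : M → M → ℝ}
  {f : ℝ → ℝ}

/-- The disagreement which does not involve agent `i` is a constant for that agent, so that `W i`
and `W` have the same gradient with respect to its state. -/
theorem exists_disagreement_update_eq_add (hw : ∀ i j, w i j = w j i) (hρ : ∀ p q, ρ p q = ρ q p)
    (x : Fin N → M) (i : Fin N) : ∃ c : ℝ, ∀ y, disagreement G w ρ f (update x i y) =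
      localDisagreement G w ρ f i (update x i y) + c := by
  classical
  let T (x : Fin N → M) (a b : Fin N) : ℝ :=
    if G.Adj a b then w a b * ∫ s in (0 : ℝ)..(ρ (x a) (x b) ^ 2), f s else 0
  refine ⟨1 / 2 * ∑ a ∈ Finset.univ.erase i, ∑ b ∈ Finset.univ.erase i,
    if a < b then T x a b else 0, fun y ↦ ?_⟩
  have hT : ∀ a b, T (update x i y) a b = T (update x i y) b a := by
    intro a b
    simp only [T, G.adj_comm a b, hw a b, hρ (update x i y a)]
  have hrest : ∑ a ∈ Finset.univ.erase i, ∑ b ∈ Finset.univ.erase i,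
        (if a < b then T (update x i y) a b else 0) =
      ∑ a ∈ Finset.univ.erase i, ∑ b ∈ Finset.univ.erase i, if a < b then T x a b else 0 := by
    refine Finset.sum_congr rfl fun a ha ↦ Finset.sum_congr rfl fun b hb ↦ ?_
    simp only [T, update_of_ne (Finset.ne_of_mem_erase ha),
      update_of_ne (Finset.ne_of_mem_erase hb)]
  have h := sum_lt_eq_sum_add_sum_erase hT (fun a ↦ by simp [T]) i
  rw [hrest] at h
  have hW : disagreement G w ρ f (update x i y) =
      1 / 2 * ∑ p : Fin N × Fin N, if p.1 < p.2 then T (update x i y) p.1 p.2 else 0 := by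
    simp only [disagreement, Finset.sum_filter, T, ite_and]
  have hWi : localDisagreement G w ρ f i (update x i y) =
      1 / 2 * ∑ j, T (update x i y) i j := by
    simp only [localDisagreement, Finset.sum_filter, T]
  rw [hW, hWi, h, mul_add]

theorem localDisagreement_nonneg (hw_pos : ∀ i j, G.Adj i j → 0 < w i j)
    (hf : ∀ p q, 0 ≤ ∫ s in (0 : ℝ)..(ρ p q ^ 2), f s) (i : Fin N) (x : Fin N → M) :
    0 ≤ localDisagreement G w ρ f i x := by
  classical
  refine mul_nonneg (by norm_num) (Finset.sum_nonneg fun j hj ↦ ?_)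
  exact mul_nonneg (hw_pos _ _ (Finset.mem_filter.1 hj).2).le (hf _ _)

theorem localDisagreement_eq_zero_of_mem (hρ : ∀ p, ρ p p = 0) (i : Fin N) {x : Fin N → M}
    (hx : x ∈ consensusManifold G M) : localDisagreement G w ρ f i x = 0 := by
  classical
  refine mul_eq_zero_of_right _ (Finset.sum_eq_zero fun j hj ↦ ?_)
  simp [hx i j (Finset.mem_filter.1 hj).2, hρ]

theorem disagreement_nonneg (hw_pos : ∀ i j, G.Adj i j → 0 < w i j)
    (hf : ∀ p q, 0 ≤ ∫ s in (0 : ℝ)..(ρ p q ^ 2), f s) (x : Fin N → M) :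
    0 ≤ disagreement G w ρ f x := by
  classical
  refine mul_nonneg (by norm_num) (Finset.sum_nonneg fun p hp ↦ ?_)
  exact mul_nonneg (hw_pos _ _ (Finset.mem_filter.1 hp).2.2).le (hf _ _)

theorem disagreement_eq_zero_iff (hw_pos : ∀ i j, G.Adj i j → 0 < w i j) (hρ : ∀ p, ρ p p = 0)
    (hf : ∀ p q, p ≠ q → 0 < ∫ s in (0 : ℝ)..(ρ p q ^ 2), f s) (x : Fin N → M) :
    disagreement G w ρ f x = 0 ↔ x ∈ consensusManifold G M := by
  classical
  have hf' : ∀ p q, 0 ≤ ∫ s in (0 : ℝ)..(ρ p q ^ 2), f s := fun p q ↦ by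
    obtain rfl | h := eq_or_ne p q
    · simp [hρ]
    · exact (hf p q h).le
  unfold disagreement
  rw [mul_eq_zero_iff_left (by norm_num), Finset.sum_eq_zero_iff_of_nonneg fun p hp ↦
    mul_nonneg (hw_pos _ _ (Finset.mem_filter.1 hp).2.2).le (hf' _ _)]
  refine ⟨fun h ↦ ?_, fun h p hp ↦ by simp [h _ _ (Finset.mem_filter.1 hp).2.2, hρ]⟩
  have key : ∀ i j, i < j → G.Adj i j → x i = x j := by
    intro i j hij hadj
    by_contra hne
    exact (mul_pos (hw_pos i j hadj) (hf _ _ hne)).ne'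
      (h (i, j) (Finset.mem_filter.2 ⟨Finset.mem_univ _, hij, hadj⟩))
  intro i j hadj
  obtain hij | hij := hadj.ne.lt_or_gt
  · exact key i j hij hadj
  · exact (key j i hij hadj.symm).symm

end Disagreement

section GradientFlow

variable {d N : ℕ} {M : Type*} [MetricSpace M] [ChartedSpace (EuclideanSpace ℝ (Fin d)) M]
  {G : SimpleGraph (Fin N)} {w : Fin N → Fin N → ℝ} {ρ : M → M → ℝ} {f : ℝ → ℝ}

/-- The partial differential of `W` with respect to the state of agent `i` is that of `W i`. -/
theorem mfderiv_localDisagreement_update (hw : ∀ i j, w i j = w j i) (hρ : ∀ p q, ρ p q = ρ q p)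
    {x : Fin N → M} {W' : (Fin N → EuclideanSpace ℝ (Fin d)) →L[ℝ] ℝ}
    (hW : HasMFDerivAt (ModelWithCorners.pi fun _ : Fin N ↦ 𝓡 d) 𝓘(ℝ, ℝ)
      (disagreement G w ρ f) x W') (i : Fin N) :
    mfderiv (𝓡 d) 𝓘(ℝ, ℝ) (fun y ↦ localDisagreement G w ρ f i (update x i y)) (x i) =
      W'.comp (ContinuousLinearMap.single ℝ (fun _ ↦ EuclideanSpace ℝ (Fin d)) i) := by
  obtain ⟨c, hc⟩ := exists_disagreement_update_eq_add (G := G) (f := f) hw hρ x i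
  have hW' : HasMFDerivAt (ModelWithCorners.pi fun _ : Fin N ↦ 𝓡 d) 𝓘(ℝ, ℝ)
      (disagreement G w ρ f) (update x i (x i)) W' := by rwa [update_eq_self]
  set D : EuclideanSpace ℝ (Fin d) →L[ℝ] ℝ :=
    W'.comp (ContinuousLinearMap.single ℝ (fun _ ↦ EuclideanSpace ℝ (Fin d)) i)
  have h : HasMFDerivAt (𝓡 d) 𝓘(ℝ, ℝ) (disagreement G w ρ f ∘ update x i) (x i) D :=
    HasMFDerivAt.comp (x i) hW' (hasMFDerivAt_update (I := fun _ : Fin N ↦ 𝓡 d) x i)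
  have hd : HasMFDerivAt (𝓡 d) 𝓘(ℝ, ℝ) (fun y ↦ localDisagreement G w ρ f i (update x i y)) (x i)
      (D - 0 : EuclideanSpace ℝ (Fin d) →L[ℝ] ℝ) :=
    (HasMFDerivAt.sub h (hasMFDerivAt_const (I := 𝓡 d) (I' := 𝓘(ℝ, ℝ)) c (x i)))
      |>.congr_of_eventuallyEq (.of_forall fun y ↦ by simp [hc])
  rw [sub_zero] at hd
  exact hd.mfderiv

variable [RiemannianBundle (fun x : M ↦ TangentSpace (𝓡 d) x)]

theorem consensusFeedback_eq_zero_of_mem (hw_pos : ∀ i j, G.Adj i j → 0 < w i j)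
    (hρ : ∀ p, ρ p p = 0) (hf : ∀ p q, 0 ≤ ∫ s in (0 : ℝ)..(ρ p q ^ 2), f s)
    {x : Fin N → M} (hx : x ∈ consensusManifold G M) (i : Fin N) :
    consensusFeedback (d := d) G w ρ f x i = 0 := by
  refine neg_eq_zero.2 (riemannianGradient_eq_zero_of_isLocalMin (.of_forall fun y ↦ ?_))
  simp only [update_eq_self, localDisagreement_eq_zero_of_mem hρ i hx]
  exact localDisagreement_nonneg hw_pos hf i _

/-- The disagreement decreases along trajectories: its derivative is minus the sum of the squared
norms of the partial gradients. -/
theorem antitoneOn_disagreement (hw : ∀ i j, w i j = w j i) (hρ : ∀ p q, ρ p q = ρ q p)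
    (hW : MDifferentiable (ModelWithCorners.pi fun _ : Fin N ↦ 𝓡 d) 𝓘(ℝ, ℝ)
      (disagreement G w ρ f)) {T : ℝ} {x : ℝ → Fin N → M}
    (hx : IsTrajectoryOn (d := d) (consensusFeedback G w ρ f) x (Icc 0 T)) :
    AntitoneOn (fun t ↦ disagreement G w ρ f (x t)) (Icc 0 T) := by
  have key : ∀ t ∈ Icc 0 T, ∃ a ≤ 0,
      HasDerivWithinAt (fun t ↦ disagreement G w ρ f (x t)) a (Icc 0 T) t := by
    intro t ht
    obtain ⟨W', hW'⟩ : ∃ W' : (Fin N → EuclideanSpace ℝ (Fin d)) →L[ℝ] ℝ,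
        HasMFDerivAt (ModelWithCorners.pi fun _ : Fin N ↦ 𝓡 d) 𝓘(ℝ, ℝ)
          (disagreement G w ρ f) (x t) W' := ⟨_, (hW (x t)).hasMFDerivAt⟩
    obtain ⟨v, hv⟩ : ∃ v : Fin N → EuclideanSpace ℝ (Fin d),
        ∀ i, v i = consensusFeedback (d := d) G w ρ f (x t) i := ⟨_, fun _ ↦ rfl⟩
    refine ⟨W' v, ?_, hW'.hasDerivWithinAt_comp_curve fun i ↦ ?_⟩
    · rw [← Finset.univ_sum_single v, map_sum]
      refine Finset.sum_nonpos fun i _ ↦ ?_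
      set φ : M → ℝ := fun y ↦ localDisagreement G w ρ f i (update (x t) i y) with hφ
      have h1 : W' (Pi.single i (v i)) =
          inner ℝ (riemannianGradient (d := d) φ (x t i)) (-riemannianGradient φ (x t i)) := by
        rw [inner_riemannianGradient, hφ, mfderiv_localDisagreement_update hw hρ hW', hv]
        rfl
      rw [h1, inner_neg_right]
      exact neg_nonpos.2 real_inner_self_nonneg
    · rw [hv]
      exact hx t ht i
  choose! a ha hd using key
  have hint : ∀ t ∈ interior (Icc 0 T), HasDerivAt (fun t ↦ disagreement G w ρ f (x t)) (a t) t :=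
    fun t ht ↦ (hd t (interior_subset ht)).hasDerivAt (mem_interior_iff_mem_nhds.1 ht)
  refine antitoneOn_of_deriv_nonpos (convex_Icc 0 T) (fun t ht ↦ (hd t ht).continuousWithinAt)
    (fun t ht ↦ (hint t ht).differentiableAt.differentiableWithinAt) fun t ht ↦ ?_
  rw [(hint t ht).deriv]
  exact ha t (interior_subset ht)

theorem isCompact_consensusManifold [CompactSpace M] : IsCompact (consensusManifold G M) := by
  have h : IsClosed (consensusManifold G M) := by
    simp only [consensusManifold, ofPred_forall]
    exact isClosed_iInter fun i ↦ isClosed_iInter fun j ↦ isClosed_iInter fun _ ↦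
      isClosed_eq (continuous_apply i) (continuous_apply j)
  exact h.isCompact

/-- The argument common to the two algorithms: the disagreement is a Lyapunov function of its own
gradient flow, with the consensus manifold as zero set. -/
theorem isLyapunovStableEquilibriumSet_consensusFeedback [CompactSpace M]
    (hw : ∀ i j, w i j = w j i) (hw_pos : ∀ i j, G.Adj i j → 0 < w i j)
    (hρ : ∀ p q, ρ p q = ρ q p) (hρ_self : ∀ p, ρ p p = 0)
    (hf : ∀ p q, p ≠ q → 0 < ∫ s in (0 : ℝ)..(ρ p q ^ 2), f s)
    (hW : MDifferentiable (ModelWithCorners.pi fun _ : Fin N ↦ 𝓡 d) 𝓘(ℝ, ℝ)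
      (disagreement G w ρ f)) :
    (∀ x, 0 ≤ disagreement G w ρ f x ∧
      (disagreement G w ρ f x = 0 ↔ x ∈ consensusManifold G M)) ∧
    IsLyapunovStableEquilibriumSet (consensusFeedback (d := d) G w ρ f)
      (consensusManifold G M) := by
  have hf' : ∀ p q, 0 ≤ ∫ s in (0 : ℝ)..(ρ p q ^ 2), f s := fun p q ↦ by
    obtain rfl | h := eq_or_ne p q
    · simp [hρ_self]
    · exact (hf p q h).le
  have h0 := disagreement_nonneg (G := G) hw_pos hf'
  have hz := disagreement_eq_zero_iff (G := G) hw_pos hρ_self hf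
  exact ⟨fun x ↦ ⟨h0 x, hz x⟩,
    fun x hx i ↦ consensusFeedback_eq_zero_of_mem hw_pos hρ_self hf' hx i,
    fun ε hε ↦ exists_pos_forall_trajectory_mem isCompact_consensusManifold hW.continuous h0 hz
      (fun T x hx ↦ antitoneOn_disagreement hw hρ hW hx) hε⟩

end GradientFlow

/-! ### The two algorithms -/

theorem consensusManifold_eq_range {N : ℕ} {M : Type*} {G : SimpleGraph (Fin N)}
    (hG : G.Connected) :
    consensusManifold G M = range (fun (p : M) (_ : Fin N) ↦ p) := by
  ext x
  refine ⟨fun hx ↦ ?_, ?_⟩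
  · obtain ⟨i⟩ := hG.nonempty
    refine ⟨x i, funext fun j ↦ ?_⟩
    obtain ⟨p⟩ := hG.preconnected i j
    induction p with
    | nil => rfl
    | cons h _ ih => exact (hx _ _ h).trans ih
  · rintro ⟨p, rfl⟩ i j _
    rfl

section Algorithms

variable {d N : ℕ} {M : Type*} [MetricSpace M] [ChartedSpace (EuclideanSpace ℝ (Fin d)) M]
  {G : SimpleGraph (Fin N)} {w : Fin N → Fin N → ℝ}

theorem mdifferentiable_disagreement_chordalDist {F : Type*} [NormedAddCommGroup F]
    [InnerProductSpace ℝ F] {ι : M → F} (hι : MDifferentiable (𝓡 d) 𝓘(ℝ, F) ι) :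
    MDifferentiable (ModelWithCorners.pi fun _ : Fin N ↦ 𝓡 d) 𝓘(ℝ, ℝ)
      (disagreement G w (chordalDist ι) fun _ ↦ 1) := by
  classical
  have h : (disagreement G w (chordalDist ι) fun _ ↦ 1) =
      (fun z : Fin N → F ↦ 1 / 2 * ∑ p : Fin N × Fin N with p.1 < p.2 ∧ G.Adj p.1 p.2,
        w p.1 p.2 * ‖z p.1 - z p.2‖ ^ 2) ∘ fun x i ↦ ι (x i) := by
    ext x
    simp only [disagreement, chordalDist, intervalIntegral.integral_const, sub_zero, smul_eq_mul,
      mul_one, comp_apply]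
  rw [h]
  refine MDifferentiable.comp (I' := 𝓘(ℝ, Fin N → F)) (Differentiable.mdifferentiable ?_) ?_
  · refine Differentiable.const_mul
      (Differentiable.fun_sum fun p _ ↦ Differentiable.const_mul ?_ _) _
    exact Differentiable.norm_sq ℝ (by fun_prop)
  · intro x
    have hx : ∀ i, MDifferentiableAt (ModelWithCorners.pi fun _ : Fin N ↦ 𝓡 d) 𝓘(ℝ, F)
        (fun x : Fin N → M ↦ ι (x i)) x := fun i ↦
      MDifferentiableAt.comp x (hι (x i))
        (hasMFDerivAt_apply (I := fun _ : Fin N ↦ 𝓡 d) x i).mdifferentiableAt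
    exact (mdifferentiableAt_iff _ _).2 ⟨continuousAt_pi.2 fun i ↦ (hx i).continuousAt,
      differentiableWithinAt_pi.2 fun i ↦ ((mdifferentiableAt_iff _ _).1 (hx i)).2⟩

variable [RiemannianBundle (fun x : M ↦ TangentSpace (𝓡 d) x)]

/-- A smoothing function is `1` on a neighbourhood of `0` in `[0, ∞)`, and integrable on bounded
intervals: if the injectivity radius `r` is finite, it is `1` up to `(r - ε) ^ 2`, continuous from
there to `r ^ 2`, and `0` afterwards. -/
theorem IsGeodesicSmoothing.exists_eqOn_one_and_intervalIntegrable {ε : ℝ} {f : ℝ → ℝ}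
    (hf : IsGeodesicSmoothing (M := M) d G w ε f) {a : ℝ} (ha : 0 < a) :
    ∃ c, 0 < c ∧ EqOn f 1 (Icc 0 c) ∧ IntervalIntegrable f MeasureTheory.volume 0 a := by
  obtain hR | hR := eq_or_ne (injectivityRadius d M) ⊤
  · have h1 : EqOn f 1 (Ici 0) := fun s hs ↦ by
      have := hf.eq_one (√s) (Real.sqrt_nonneg s) (by simp [hR])
      rwa [Real.sq_sqrt hs] at this
    refine ⟨1, one_pos, h1.mono Icc_subset_Ici_self, ?_⟩
    refine (intervalIntegrable_const (c := (1 : ℝ))).congr fun s hs ↦ (h1 ?_).symm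
    rw [uIoc_of_le ha.le] at hs
    exact hs.1.le
  obtain ⟨r, hr, hRr⟩ : ∃ r, 0 ≤ r ∧ injectivityRadius d M = ENNReal.ofReal r :=
    ⟨_, ENNReal.toReal_nonneg, (ENNReal.ofReal_toReal hR).symm⟩
  have hε := hf.pos
  have hεr : ε < r := by
    have h := hf.lt_radius
    rw [hRr] at h
    exact (ENNReal.ofReal_lt_ofReal_iff_of_nonneg hε.le).1 h
  have hsub : injectivityRadius d M - ENNReal.ofReal ε = ENNReal.ofReal (r - ε) := by
    rw [hRr, ENNReal.ofReal_sub _ hε.le]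
  have hc : 0 < r - ε := sub_pos.2 hεr
  have h1 : EqOn f 1 (Icc 0 ((r - ε) ^ 2)) := fun s hs ↦ by
    have h := hf.eq_one (√s) (Real.sqrt_nonneg s)
      (hsub ▸ ENNReal.ofReal_le_ofReal (Real.sqrt_le_iff.2 ⟨hc.le, hs.2⟩))
    rwa [Real.sq_sqrt hs.1] at h
  have h2 : ContinuousOn f (Icc ((r - ε) ^ 2) (r ^ 2)) := by
    refine hf.smooth.continuousOn.mono fun s hs ↦ ?_
    have hs0 : 0 ≤ s := (sq_nonneg _).trans hs.1
    refine ⟨√s, ⟨Real.sqrt_nonneg s, ?_, ?_⟩, Real.sq_sqrt hs0⟩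
    · exact hsub ▸ ENNReal.ofReal_le_ofReal (Real.le_sqrt_of_sq_le hs.1)
    · exact hRr ▸ ENNReal.ofReal_le_ofReal (Real.sqrt_le_iff.2 ⟨hr, hs.2⟩)
  have h3 : EqOn f 0 (Ici (r ^ 2)) := fun s hs ↦ by
    have h := hf.eq_zero (√s) (Real.sqrt_nonneg s)
      (hRr ▸ ENNReal.ofReal_le_ofReal (Real.le_sqrt_of_sq_le hs))
    rwa [Real.sq_sqrt ((sq_nonneg r).trans hs)] at h
  have hcr : (r - ε) ^ 2 ≤ r ^ 2 := by gcongr; linarith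
  refine ⟨(r - ε) ^ 2, by positivity, h1, ?_⟩
  have i1 : IntervalIntegrable f MeasureTheory.volume 0 ((r - ε) ^ 2) := by
    refine (intervalIntegrable_const (c := (1 : ℝ))).congr fun s hs ↦ (h1 ?_).symm
    rw [uIoc_of_le (sq_nonneg _)] at hs
    exact Ioc_subset_Icc_self hs
  have i2 : IntervalIntegrable f MeasureTheory.volume ((r - ε) ^ 2) (r ^ 2) :=
    h2.intervalIntegrable_of_Icc hcr
  have i3 : IntervalIntegrable f MeasureTheory.volume (r ^ 2) (max a (r ^ 2)) := by
    refine (intervalIntegrable_const (c := (0 : ℝ))).congr fun s hs ↦ (h3 ?_).symm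
    rw [uIoc_of_le (le_max_right _ _)] at hs
    exact hs.1.le
  refine ((i1.trans i2).trans i3).mono_set ?_
  rw [uIcc_of_le ha.le, uIcc_of_le (ha.le.trans (le_max_left _ _))]
  exact Icc_subset_Icc_right (le_max_left _ _)

theorem IsGeodesicSmoothing.integral_pos {ε : ℝ} {f : ℝ → ℝ}
    (hf : IsGeodesicSmoothing (M := M) d G w ε f) {a : ℝ} (ha : 0 < a) :
    0 < ∫ s in (0 : ℝ)..a, f s := by
  obtain ⟨c, hc, h1, hint⟩ := hf.exists_eqOn_one_and_intervalIntegrable ha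
  have h0 : ∀ s, 0 ≤ f s := fun s ↦ (hf.mem_Icc s).1
  have hm : 0 < min a c := lt_min ha hc
  calc (0 : ℝ) < ∫ _ in (0 : ℝ)..min a c, (1 : ℝ) := by simpa using hm
    _ = ∫ s in (0 : ℝ)..min a c, f s := by
      refine intervalIntegral.integral_congr fun s hs ↦ (h1 ?_).symm
      rw [uIcc_of_le hm.le] at hs
      exact ⟨hs.1, hs.2.trans (min_le_right _ _)⟩
    _ ≤ ∫ s in (0 : ℝ)..a, f s :=
      intervalIntegral.integral_mono_interval le_rfl hm.le (min_le_left _ _) (.of_forall h0) hint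

end Algorithms

theorem mainTheorem6 {d : ℕ} {M : Type*} [MetricSpace M] [CompactSpace M] [Nonempty M]
    [ChartedSpace (EuclideanSpace ℝ (Fin d)) M] [IsManifold (𝓡 d) ∞ M]
    [RiemannianBundle (fun x : M ↦ TangentSpace (𝓡 d) x)]
    [IsContMDiffRiemannianBundle (𝓡 d) ∞ (EuclideanSpace ℝ (Fin d))
      (fun x : M ↦ TangentSpace (𝓡 d) x)]
    [IsRiemannianManifold (𝓡 d) M]
    {N : ℕ} (G : SimpleGraph (Fin N)) (hG : G.Connected)
    (w : Fin N → Fin N → ℝ) (hw_symm : ∀ i j, w i j = w j i)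
    (hw_pos : ∀ i j, G.Adj i j → 0 < w i j) :
    -- the consensus manifold is the diagonal, a compact embedded copy of `M` in `M ^ N`
    (consensusManifold G M = Set.range (fun (p : M) (_ : Fin N) ↦ p) ∧
      IsSmoothEmbedding (𝓡 d) (ModelWithCorners.pi fun _ : Fin N ↦ 𝓡 d) ∞
        (fun (p : M) (_ : Fin N) ↦ p) ∧
      IsCompact (consensusManifold G M)) ∧
    -- geodesic consensus
    (∀ (ε : ℝ) (f : ℝ → ℝ), IsGeodesicSmoothing (M := M) d G w ε f →
      (∀ x : Fin N → M, 0 ≤ disagreement G w (fun p q : M ↦ dist p q) f x ∧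
        (disagreement G w (fun p q : M ↦ dist p q) f x = 0 ↔ x ∈ consensusManifold G M)) ∧
      IsLyapunovStableEquilibriumSet (geodesicConsensus d G w f) (consensusManifold G M)) ∧
    -- chordal consensus
    (∀ (n m : ℕ) (ι : M → EuclideanSpace ℝ (Fin n × Fin m)), IsIsometricEmbedding (d := d) ι →
      (∀ x : Fin N → M, 0 ≤ disagreement G w (chordalDist ι) (fun _ ↦ 1) x ∧
        (disagreement G w (chordalDist ι) (fun _ ↦ 1) x = 0 ↔ x ∈ consensusManifold G M)) ∧
      IsLyapunovStableEquilibriumSet (chordalConsensus d ι G w) (consensusManifold G M)) := by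
  have := hG.nonempty
  refine ⟨⟨consensusManifold_eq_range hG, isSmoothEmbedding_diagonal,
    isCompact_consensusManifold⟩, fun ε f hf ↦ ?_, fun n m ι hι ↦ ?_⟩
  · exact isLyapunovStableEquilibriumSet_consensusFeedback hw_symm hw_pos dist_comm dist_self
      (fun p q hpq ↦ hf.integral_pos (pow_pos (dist_pos.2 hpq) 2))
      (hf.contMDiff.mdifferentiable two_ne_zero)
  · refine isLyapunovStableEquilibriumSet_consensusFeedback hw_symm hw_pos
      (fun p q ↦ norm_sub_rev _ _) (fun p ↦ by simp [chordalDist]) (fun p q hpq ↦ ?_)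
      (mdifferentiable_disagreement_chordalDist
        (hι.isSmoothEmbedding.contMDiff.mdifferentiable (by simp)))
    have h : 0 < ‖ι p - ι q‖ ^ 2 :=
      pow_pos (norm_sub_pos_iff.2 (hι.isSmoothEmbedding.isEmbedding.injective.ne hpq)) 2
    simpa only [chordalDist, intervalIntegral.integral_const, sub_zero, smul_eq_mul, mul_one]
      using h
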